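/- Let $(\mathbb U,d)$ be the Urysohn space, i.e. the complete separable metric space (unique up to isometry) such that for every finite metric space $X$ and every $X_0\subseteq X$, each isometric embedding $X_0\to\mathbb U$ extends to an isometric embedding $X\to\mathbb U$. A $1$-Lipschitz retraction of a metric space $X$ is a $1$-Lipschitz map $R\colon X\to X$ with $R\circ R=R$; put $D_R(x)=\operatorname{dist}(x,R[X])$. Let $\mathcal R(\mathbb U)$ be the set of all $1$-Lipschitz retractions of $\mathbb U$. We call $U\in\mathcal R(\mathbb U)$ - universal if for every separable metric space $X$ and every $1$-Lipschitz retraction $R$ of $X$ there is an isometric embedding $i\colon X\to\mathbb U$ with $i\circ R=U\circ i$ and $D_R=D_U\circ i$; - ultrahomogeneous if for all finite $A_1,A_2\subseteq\mathbb U$ with $U[A_1]\subseteq A_1$, every surjective isometry $i\colon A_1\to A_2$ with $i(U(x))=U(i(x))$ and $D_U(x)=D_U(i(x))$ for all $x\in A_1$ extends to a surjective isometry $I\colon\mathbb U\to\mathbb U$ with $I\circ U=U\circ I$ and $D_U=D_U\circ I$. Let $\mathcal U(\mathbb U)$ be the set of all universal and ultrahomogeneous $U\in\mathcal R(\mathbb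 U)$. Equip $\mathcal R(\mathbb U)$ with the topology $\tau_p$ of pointwise convergence, the topology $\tau_u$ of uniform convergence, and the topology $\tau_{pr}$ in which the basic neighbourhoods of $U$ are the sets $$\{R\in\mathcal R(\mathbb U): d(R(x),U(x))<\varepsilon\ \text{and}\ |D_U(x)-D_R(x)|<\varepsilon\ \text{for all } x\in X\},\qquad X\subset\mathbb U\ \text{finite},\ \varepsilon>0.$$ For $F\subseteq\mathbb U$ let $\mathcal R(\mathbb U,F)$ and $\mathcal U(\mathbb U,F)$ be the sets of those $R$ in $\mathcal R(\mathbb U)$, respectively in $\mathcal U(\mathbb U)$, with $R[\mathbb U]=F$. Then: 1. $\mathcal U(\mathbb U)$ is a $G_{\delta\sigma\delta}$ subset (a countable intersection of countable unions of $G_\delta$ sets) of $(\mathcal R(\mathbb U),\tau_p)$. 2. $\mathcal U(\mathbb U)$ is a $G_\delta$ subset of $(\mathcal R(\mathbb U),\tau_{pr})$ and of $(\mathcal R(\mathbb U),\tau_u)$. 3. For every $F\subseteq\mathbb U$ that is the image of some $1$-Lipschitz retraction of $\mathbb U$ (in particular, for the image of any universal and ultrahomogeneous one), the subspace topologies induced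 by $\tau_p$ and $\tau_{pr}$ on $\mathcal R(\mathbb U,F)$ coincide, and $\mathcal U(\mathbb U,F)$ is a $G_\delta$ subset of $\mathcal R(\mathbb U,F)$ in $\tau_p=\tau_{pr}$ and in $\tau_u$. -/

import Mathlib

open Set Topology

/-- `𝕌` is the Urysohn space: a complete separable metric space with the extension property for
finite metric spaces (these data determine it up to isometry). -/
structure IsUrysohnSpace (𝕌 : Type*) [MetricSpace 𝕌] : Prop where
  complete : CompleteSpace 𝕌
  separable : TopologicalSpace.SeparableSpace 𝕌
  extension : ∀ (X : Type) [MetricSpace X] [Finite X] (X₀ : Set X) (f : X₀ → 𝕌), Isometry f →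
    ∃ g : X → 𝕌, Isometry g ∧ ∀ x : X₀, g x = f x

/-- A `1`-Lipschitz retraction of `X`: a `1`-Lipschitz self-map that is the identity on its
image. -/
def IsLipRetraction {X : Type*} [MetricSpace X] (R : X → X) : Prop :=
  LipschitzWith 1 R ∧ ∀ x, R (R x) = R x

/-- `distRange R x` is the distance of `x` from the image of `R`. -/
noncomputable def distRange {X : Type*} [MetricSpace X] (R : X → X) (x : X) : ℝ :=
  Metric.infDist x (range R)

/-- Universality of a `1`-Lipschitz retraction. Every separable metric space has at most
continuum many points, so the spaces `X : Type` represent all of them up to isometry. -/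
def IsUniversalRetraction {𝕌 : Type*} [MetricSpace 𝕌] (U : 𝕌 → 𝕌) : Prop :=
  ∀ (X : Type) [MetricSpace X] [TopologicalSpace.SeparableSpace X] (R : X → X),
    IsLipRetraction R →
    ∃ i : X → 𝕌, Isometry i ∧ ∀ x, i (R x) = U (i x) ∧ distRange R x = distRange U (i x)

/-- Ultrahomogeneity of a `1`-Lipschitz retraction: every isomorphism between finite
substructures (finite sets closed under `U`) extends to an automorphism. -/
def IsUltrahomogeneousRetraction {𝕌 : Type*} [MetricSpace 𝕌] (U : 𝕌 → 𝕌) : Prop :=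
  ∀ (A₁ A₂ : Set 𝕌) (_ : A₁.Finite) (_ : A₂.Finite) (hA : MapsTo U A₁ A₁) (i : A₁ ≃ᵢ A₂),
    (∀ x : A₁, (i ⟨U x, hA x.2⟩ : 𝕌) = U (i x)) →
    (∀ x : A₁, distRange U (x : 𝕌) = distRange U (i x : 𝕌)) →
    ∃ I : 𝕌 ≃ᵢ 𝕌, (∀ x : A₁, I x = i x) ∧ (∀ x, I (U x) = U (I x)) ∧
      ∀ x, distRange U x = distRange U (I x)

/-- The set of all `1`-Lipschitz retractions of `𝕌`, as a type. -/
def LipRetractions (𝕌 : Type*) [MetricSpace 𝕌] : Type _ :=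
  {R : 𝕌 → 𝕌 // IsLipRetraction R}

namespace LipRetractions

variable {𝕌 : Type*} [MetricSpace 𝕌]

/-- The topology of pointwise convergence. -/
@[reducible] def pointwiseTopology (𝕌 : Type*) [MetricSpace 𝕌] : TopologicalSpace (LipRetractions 𝕌) :=
  TopologicalSpace.induced (fun R => R.1) Pi.topologicalSpace

/-- The topology of uniform convergence. -/
@[reducible] def uniformTopology (𝕌 : Type*) [MetricSpace 𝕌] : TopologicalSpace (LipRetractions 𝕌) :=
  TopologicalSpace.induced (fun R => UniformFun.ofFun R.1) (UniformFun.topologicalSpace 𝕌 𝕌)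

/-- The basic neighbourhood of `U` for pointwise retract convergence given by a finite set `X`
and `ε`. -/
def retractNhd (U : LipRetractions 𝕌) (X : Finset 𝕌) (ε : ℝ) : Set (LipRetractions 𝕌) :=
  {R | ∀ x ∈ X, dist (R.1 x) (U.1 x) < ε ∧ |distRange U.1 x - distRange R.1 x| < ε}

/-- The topology of pointwise retract convergence: a set is open if it contains a basic
neighbourhood of each of its points. -/
@[reducible] def retractTopology (𝕌 : Type*) [MetricSpace 𝕌] : TopologicalSpace (LipRetractions 𝕌) where
  IsOpen S := ∀ U ∈ S, ∃ (X : Finset 𝕌) (ε : ℝ), 0 < ε ∧ retractNhd U X ε ⊆ S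
  isOpen_univ := fun _ _ => ⟨∅, 1, one_pos, subset_univ _⟩
  isOpen_inter := by
    classical
    intro S T hS hT U hU
    obtain ⟨X, ε, hε, hX⟩ := hS U hU.1
    obtain ⟨Y, δ, hδ, hY⟩ := hT U hU.2
    refine ⟨X ∪ Y, min ε δ, lt_min hε hδ, fun R hR => ⟨hX fun x hx => ?_, hY fun x hx => ?_⟩⟩
    · have h := hR x (Finset.mem_union_left _ hx)
      exact ⟨h.1.trans_le (min_le_left _ _), h.2.trans_le (min_le_left _ _)⟩
    · have h := hR x (Finset.mem_union_right _ hx)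
      exact ⟨h.1.trans_le (min_le_right _ _), h.2.trans_le (min_le_right _ _)⟩
  isOpen_sUnion := by
    intro 𝒮 h𝒮 U hU
    obtain ⟨S, hS, hUS⟩ := hU
    obtain ⟨X, ε, hε, hX⟩ := h𝒮 S hS U hUS
    exact ⟨X, ε, hε, hX.trans (subset_sUnion_of_mem hS)⟩

/-- The set of universal and ultrahomogeneous `1`-Lipschitz retractions of `𝕌`. -/
def universalUltrahomogeneous (𝕌 : Type*) [MetricSpace 𝕌] : Set (LipRetractions 𝕌) :=
  {U | IsUniversalRetraction U.1 ∧ IsUltrahomogeneousRetraction U.1}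

/-- The set of `1`-Lipschitz retractions of `𝕌` with image `F`. -/
def onto (F : Set 𝕌) : Set (LipRetractions 𝕌) :=
  {R | range R.1 = F}

/-- The universal and ultrahomogeneous retractions with image `F`, as a subset of the subspace of
all `1`-Lipschitz retractions with image `F`. -/
def universalUltrahomogeneousOnto (F : Set 𝕌) : Set (onto F) :=
  {U | (U : LipRetractions 𝕌) ∈ universalUltrahomogeneous 𝕌}

/-- The subspace topology on `onto F` inherited from a topology on all retractions. -/
@[reducible] def subspaceTopology (τ : TopologicalSpace (LipRetractions 𝕌)) (F : Set 𝕌) :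
    TopologicalSpace (onto F) :=
  TopologicalSpace.induced Subtype.val τ

end LipRetractions

/-- A countable union of `Gδ` sets. -/
def IsGδσ {X : Type*} [TopologicalSpace X] (S : Set X) : Prop :=
  ∃ f : ℕ → Set X, (∀ n, IsGδ (f n)) ∧ S = ⋃ n, f n

/-- A countable intersection of countable unions of `Gδ` sets. -/
def IsGδσδ {X : Type*} [TopologicalSpace X] (S : Set X) : Prop :=
  ∃ f : ℕ → Set X, (∀ n, IsGδσ (f n)) ∧ S = ⋂ n, f n

/-! Being universal and ultrahomogeneous is equivalent to an extension property over finite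
structures `(d, R, D)`, where `D` stands for the distance from the image of `R`: every embedding of
an `R`-closed part of a finite structure into `(𝕌, U, D_U)` extends to the whole (`HasExtension`).
In one direction, realize the finite structure by an actual retraction, embed it by universality and
move it into place by an automorphism. In the other, run a back-and-forth along a dense sequence and
pass to the completion.

By completeness of `𝕌`, exact extension follows from approximate extension, because errors can be
corrected successively by moves that decrease geometrically (`HasApproxExtension.refine`). Both this
correction and the passage from exact to approximate extension rest on amalgamating a finite
structure with a finite part of `𝕌` (`exists_amalgam`). Approximate extension needs testing only on
countably many data: structures from a dense family, maps into a dense sequence, rational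
tolerances. For fixed data the test `StrictExtends` says "a closed condition implies an open one" in
the values of `U` and `D_U`, hence is open for `τ_pr`. So the set is `Gδ` for `τ_pr`, and for the
finer `τ_u`.

For `τ_p`, the function `D_R` is a pointwise limit of continuous functions of `R`, so `τ_pr`-open
sets are countable unions of `Gδ` sets. When the image `F` is fixed, `D_R` is the distance from `F`
and does not depend on `R`, so `τ_p` and `τ_pr` agree. -/

/-- A pseudometric `d`, a `1`-Lipschitz retraction `R` and a function `D` that satisfies the axioms
of a distance function from the image of a `1`-Lipschitz retraction. -/
structure RetractStructure (X : Type*) where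
  /-- The pseudometric. -/
  d : X → X → ℝ
  /-- The retraction. -/
  R : X → X
  /-- The prescribed distance from the image of the retraction. -/
  D : X → ℝ
  d_self : ∀ x, d x x = 0
  d_comm : ∀ x y, d x y = d y x
  d_triangle : ∀ x y z, d x z ≤ d x y + d y z
  d_R_le : ∀ x y, d (R x) (R y) ≤ d x y
  R_R : ∀ x, R (R x) = R x
  D_le : ∀ x y, D x ≤ d x y + D y
  D_R : ∀ x, D (R x) = 0
  d_self_R_le : ∀ x, d x (R x) ≤ 2 * D x

namespace RetractStructure

variable {X Y : Type*}

theorem d_nonneg (S : RetractStructure X) (x y : X) : 0 ≤ S.d x y := by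
  have h := S.d_triangle x y x
  rw [S.d_self, S.d_comm y x] at h
  linarith

theorem D_nonneg (S : RetractStructure X) (x : X) : 0 ≤ S.D x := by
  have h := S.d_self_R_le x
  have := S.d_nonneg x (S.R x)
  linarith

/-- The structure induced on `Y` by a map to `X` that commutes with the retractions. -/
@[simps] def comap (S : RetractStructure X) (f : Y → X) (ρ : Y → Y) (hρ : ∀ y, ρ (ρ y) = ρ y)
    (hf : ∀ y, f (ρ y) = S.R (f y)) : RetractStructure Y where
  d x y := S.d (f x) (f y)
  R := ρ
  D x := S.D (f x)
  d_self _ := S.d_self _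
  d_comm _ _ := S.d_comm _ _
  d_triangle _ _ _ := S.d_triangle _ _ _
  d_R_le x y := by rw [hf, hf]; exact S.d_R_le _ _
  R_R := hρ
  D_le _ _ := S.D_le _ _
  D_R x := by rw [hf]; exact S.D_R _
  d_self_R_le x := by rw [hf]; exact S.d_self_R_le _

end RetractStructure

/-! ### Retractions as structures -/

section Retraction

variable {X : Type*} [MetricSpace X] {R : X → X}

theorem distRange_le (R : X → X) (x y : X) : distRange R x ≤ dist x y + distRange R y := by
  rw [add_comm]
  exact Metric.infDist_le_infDist_add_dist

theorem continuous_distRange (R : X → X) : Continuous (distRange R) :=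
  Metric.continuous_infDist_pt _

theorem IsLipRetraction.dist_le (hR : IsLipRetraction R) (x y : X) :
    dist (R x) (R y) ≤ dist x y := by
  simpa using hR.1.dist_le_mul x y

/-- Any image point `R y` is fixed, so going from `x` to `R x` through `R y` costs at most twice
`dist x (R y)`. -/
theorem IsLipRetraction.dist_self_le (hR : IsLipRetraction R) (x : X) :
    dist x (R x) ≤ 2 * distRange R x := by
  have : dist x (R x) / 2 ≤ distRange R x := by
    refine (Metric.le_infDist ⟨R x, mem_range_self x⟩).2 ?_
    rintro _ ⟨y, rfl⟩
    have h₁ := dist_triangle x (R y) (R x)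
    have h₂ := hR.dist_le (R y) x
    rw [hR.2, dist_comm (R y) x] at h₂
    linarith
  linarith

theorem distRange_self (R : X → X) (x : X) : distRange R (R x) = 0 :=
  Metric.infDist_zero_of_mem (mem_range_self x)

/-- The structure on a metric space given by a `1`-Lipschitz retraction. -/
noncomputable def IsLipRetraction.toStructure (hR : IsLipRetraction R) :
    RetractStructure X where
  d := dist
  R := R
  D := distRange R
  d_self := dist_self
  d_comm := dist_comm
  d_triangle := dist_triangle
  d_R_le := hR.dist_le
  R_R := hR.2
  D_le := distRange_le R
  D_R := distRange_self R
  d_self_R_le := hR.dist_self_le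

end Retraction

/-! ### Gluing finite structures and realizing them by retractions -/

namespace RetractStructure

/-- The disjoint sum of two structures with a prescribed distance `c` between the summands. -/
@[simps] def sum {X Y : Type*} (S : RetractStructure X) (T : RetractStructure Y) (c : X → Y → ℝ)
    (hl : ∀ x x' y, c x y ≤ S.d x x' + c x' y) (hr : ∀ x y y', c x y ≤ c x y' + T.d y' y)
    (hl' : ∀ x x' y, S.d x x' ≤ c x y + c x' y) (hr' : ∀ x y y', T.d y y' ≤ c x y + c x y')
    (hR : ∀ x y, c (S.R x) (T.R y) ≤ c x y) (hD : ∀ x y, |S.D x - T.D y| ≤ c x y) :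
    RetractStructure (X ⊕ Y) where
  d
    | .inl x, .inl x' => S.d x x'
    | .inl x, .inr y => c x y
    | .inr y, .inl x => c x y
    | .inr y, .inr y' => T.d y y'
  R := Sum.map S.R T.R
  D := Sum.elim S.D T.D
  d_self := by rintro (x | x); exacts [S.d_self x, T.d_self x]
  d_comm := by rintro (x | x) (y | y); exacts [S.d_comm x y, rfl, rfl, T.d_comm x y]
  d_triangle := by
    rintro (x | x) (y | y) (z | z) <;> dsimp only
    · exact S.d_triangle x y z
    · exact hl x y z
    · exact hl' x z y
    · exact hr x z y
    · have := hl z y x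
      rw [S.d_comm] at this
      linarith
    · exact hr' y x z
    · have := hr z x y
      rw [T.d_comm] at this
      linarith
    · exact T.d_triangle x y z
  d_R_le := by rintro (x | x) (y | y); exacts [S.d_R_le x y, hR x y, hR y x, T.d_R_le x y]
  R_R := by rintro (x | x); exacts [congrArg Sum.inl (S.R_R x), congrArg Sum.inr (T.R_R x)]
  D_le := by
    rintro (x | x) (y | y)
    · exact S.D_le x y
    · have := (abs_le.1 (hD x y)).2
      dsimp only [Sum.elim_inl, Sum.elim_inr]
      linarith
    · have := (abs_le.1 (hD y x)).1
      dsimp only [Sum.elim_inl, Sum.elim_inr]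
      linarith
    · exact T.D_le x y
  D_R := by rintro (x | x); exacts [S.D_R x, T.D_R x]
  d_self_R_le := by rintro (x | x); exacts [S.d_self_R_le x, T.d_self_R_le x]

/-- Two finite structures can be glued along a map `Φ` that is an approximate embedding, with errors
controlled by the weights `w`. -/
theorem exists_glue {X Z : Type*} [Finite Z] (S : RetractStructure X) (T : RetractStructure Z)
    (Φ : Z → X) (w : Z → ℝ) (hΦ : ∀ z, Φ (T.R z) = S.R (Φ z)) (hw : ∀ z, w (T.R z) ≤ w z)
    (hd : ∀ p q, |S.d (Φ p) (Φ q) - T.d p q| ≤ w p + w q)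
    (hD : ∀ p, |S.D (Φ p) - T.D p| ≤ w p) :
    ∃ W : RetractStructure (X ⊕ Z), (∀ x y, W.d (.inl x) (.inl y) = S.d x y) ∧
      (∀ x y, W.d (.inr x) (.inr y) = T.d x y) ∧ (∀ x, W.R (.inl x) = .inl (S.R x)) ∧
      (∀ x, W.R (.inr x) = .inr (T.R x)) ∧ (∀ x, W.D (.inl x) = S.D x) ∧
      (∀ x, W.D (.inr x) = T.D x) ∧ ∀ z, W.d (.inl (Φ z)) (.inr z) ≤ w z := by
  -- Length of the path from `x` to `z` that crosses between the summands at `p`, at cost `w p`; the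
  -- glued distance is the minimum over `p`.
  let g : X → Z → Z → ℝ := fun x z p => S.d x (Φ p) + w p + T.d p z
  have hle : ∀ x z p, (⨅ p, g x z p) ≤ g x z p := fun x z p => ciInf_le (finite_range _).bddBelow p
  have hex : ∀ x z, ∃ p, g x z p = ⨅ p, g x z p := fun x z => by
    have : Nonempty Z := ⟨z⟩
    exact exists_eq_ciInf_of_finite
  have hd₁ : ∀ p q, S.d (Φ p) (Φ q) ≤ T.d p q + w p + w q := fun p q => by
    linarith [(abs_le.1 (hd p q)).2]
  have hd₂ : ∀ p q, T.d p q ≤ S.d (Φ p) (Φ q) + w p + w q := fun p q => by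
    linarith [(abs_le.1 (hd p q)).1]
  refine ⟨S.sum T (fun x z => ⨅ p, g x z p) ?_ ?_ ?_ ?_ ?_ ?_, fun _ _ => rfl, fun _ _ => rfl,
    fun _ => rfl, fun _ => rfl, fun _ => rfl, fun _ => rfl, fun z => ?_⟩
  · intro x x' z
    obtain ⟨p, hp⟩ := hex x' z
    rw [← hp]
    have := hle x z p
    have := S.d_triangle x x' (Φ p)
    dsimp only [g] at *
    linarith
  · intro x z z'
    obtain ⟨p, hp⟩ := hex x z'
    rw [← hp]
    have := hle x z p
    have := T.d_triangle p z' z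
    dsimp only [g] at *
    linarith
  · intro x x' z
    obtain ⟨p, hp⟩ := hex x z
    obtain ⟨q, hq⟩ := hex x' z
    rw [← hp, ← hq]
    dsimp only [g]
    have h₁ := S.d_triangle x (Φ p) x'
    have h₂ := S.d_triangle (Φ p) (Φ q) x'
    have h₃ := T.d_triangle p z q
    have h₄ := hd₁ p q
    rw [S.d_comm (Φ q) x'] at h₂
    rw [T.d_comm z q] at h₃
    linarith
  · intro x z z'
    obtain ⟨p, hp⟩ := hex x z
    obtain ⟨q, hq⟩ := hex x z'
    rw [← hp, ← hq]
    dsimp only [g]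
    have h₁ := T.d_triangle z p z'
    have h₂ := T.d_triangle p q z'
    have h₃ := S.d_triangle (Φ p) x (Φ q)
    have h₄ := hd₂ p q
    rw [T.d_comm z p] at h₁
    rw [S.d_comm (Φ p) x] at h₃
    linarith
  · intro x z
    obtain ⟨p, hp⟩ := hex x z
    rw [← hp]
    have h₁ := hle (S.R x) (T.R z) (T.R p)
    have h₂ := S.d_R_le x (Φ p)
    have h₃ := T.d_R_le p z
    have h₄ := hw p
    dsimp only [g] at *
    rw [hΦ] at h₁
    linarith
  · intro x z
    obtain ⟨p, hp⟩ := hex x z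
    rw [← hp]
    dsimp only [g]
    have h₁ := abs_le.1 (hD p)
    have h₂ := S.D_le x (Φ p)
    have h₃ := S.D_le (Φ p) x
    have h₄ := T.D_le p z
    have h₅ := T.D_le z p
    rw [S.d_comm (Φ p) x] at h₃
    rw [T.d_comm z p] at h₅
    exact abs_le.2 ⟨by linarith, by linarith⟩
  · have := hle (Φ z) z z
    dsimp only [g] at this
    rw [S.d_self, T.d_self] at this
    simpa using this

/-- Every structure embeds into one in which `D` is the attained distance from the image. -/
theorem exists_attained {X : Type*} (S : RetractStructure X) :
    ∃ W : RetractStructure (X ⊕ X), (∀ x y, W.d (.inl x) (.inl y) = S.d x y) ∧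
      (∀ x, W.R (.inl x) = .inl (S.R x)) ∧ (∀ x, W.D (.inl x) = S.D x) ∧
      ∀ z, ∃ w, W.d z (W.R w) ≤ W.D z := by
  classical
  -- The second copy of `X` consists of new fixed points: `x'` is to lie at distance `D x` from both
  -- `x` and `R x`. The distance `e` between new points is that of the path through `R x` and `R y`.
  let e : X → X → ℝ := fun x y => if x = y then 0 else S.D x + S.D y + S.d (S.R x) (S.R y)
  have he : ∀ x y, e x y ≤ S.D x + S.D y + S.d (S.R x) (S.R y) := fun x y => by
    dsimp only [e]
    split_ifs
    · linarith [S.D_nonneg x, S.D_nonneg y, S.d_nonneg (S.R x) (S.R y)]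
    · exact le_rfl
  have he₀ : ∀ x y, 0 ≤ e x y := fun x y => by
    dsimp only [e]
    split_ifs
    · exact le_rfl
    · linarith [S.D_nonneg x, S.D_nonneg y, S.d_nonneg (S.R x) (S.R y)]
  have hne : ∀ {x y}, x ≠ y → e x y = S.D x + S.D y + S.d (S.R x) (S.R y) := fun h => if_neg h
  let T : RetractStructure X :=
    { d := e
      R := id
      D := fun _ => 0
      d_self := fun x => if_pos rfl
      d_comm := fun x y => by
        dsimp only [e]
        rw [S.d_comm, add_comm (S.D x), if_congr eq_comm rfl rfl]
      d_triangle := fun x y z => by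
        by_cases hxy : x = y
        · subst hxy
          linarith [he₀ x x]
        by_cases hyz : y = z
        · subst hyz
          linarith [he₀ y y]
        rw [hne hxy, hne hyz]
        linarith [he x z, S.d_triangle (S.R x) (S.R y) (S.R z), S.D_nonneg y]
      d_R_le := fun _ _ => le_rfl
      R_R := fun _ => rfl
      D_le := fun x y => by simpa using he₀ x y
      D_R := fun _ => rfl
      d_self_R_le := fun x => by simp [e] }
  have hRR : ∀ x z, S.d (S.R x) (S.R z) ≤ S.d (S.R x) z := fun x z => by
    simpa only [S.R_R] using S.d_R_le (S.R x) z
  have hmin : ∀ x z, S.d (S.R x) (S.R z) ≤ min (S.d x z) (S.d (S.R x) z) := fun x z =>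
    le_min (S.d_R_le x z) (hRR x z)
  -- A path from `z` to `x'` may enter through `x` or through `R x`. The second route keeps the
  -- retraction `1`-Lipschitz, and `d x (R x) ≤ 2 * D x` ensures that no old distance is shortened.
  refine ⟨S.sum T (fun z x => S.D x + min (S.d x z) (S.d (S.R x) z)) ?_ ?_ ?_ ?_ ?_ ?_,
    fun _ _ => rfl, fun _ => rfl, fun _ => rfl, ?_⟩
  · intro z z' x
    have h₁ := S.d_triangle x z' z
    have h₂ := S.d_triangle (S.R x) z' z
    rw [S.d_comm z' z] at h₁ h₂
    rcases min_cases (S.d x z') (S.d (S.R x) z') with h | h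
    · linarith [min_le_left (S.d x z) (S.d (S.R x) z)]
    · linarith [min_le_right (S.d x z) (S.d (S.R x) z)]
  · intro z x y
    change _ ≤ _ + e y x
    by_cases hxy : y = x
    · subst hxy
      linarith [he₀ y y]
    rw [hne hxy]
    have h₁ := S.d_triangle (S.R x) (S.R y) z
    have h₂ := S.d_triangle (S.R y) y z
    have h₃ := S.d_self_R_le y
    have h₄ := S.D_nonneg y
    rw [S.d_comm] at h₃
    rw [S.d_comm (S.R x) (S.R y)] at h₁
    rcases min_cases (S.d y z) (S.d (S.R y) z) with h | h <;>
    linarith [min_le_right (S.d x z) (S.d (S.R x) z)]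
  · intro z z' x
    have h₁ := S.d_triangle z x z'
    have h₂ := S.d_triangle z (S.R x) z'
    have h₃ := S.d_triangle x (S.R x) z
    have h₄ := S.d_triangle x (S.R x) z'
    have h₅ := S.d_self_R_le x
    have h₆ := S.D_nonneg x
    rw [S.d_comm z x] at h₁
    rw [S.d_comm z (S.R x)] at h₂
    rcases min_cases (S.d x z) (S.d (S.R x) z) with h | h <;>
    rcases min_cases (S.d x z') (S.d (S.R x) z') with h' | h' <;> linarith
  · intro z x y
    refine (he x y).trans ?_
    have h₁ := S.d_triangle (S.R x) (S.R z) (S.R y)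
    rw [S.d_comm (S.R z) (S.R y)] at h₁
    linarith [hmin x z, hmin y z]
  · intro z x
    have := hmin x z
    change S.D x + min (S.d x (S.R z)) (S.d (S.R x) (S.R z)) ≤ _
    linarith [min_le_right (S.d x (S.R z)) (S.d (S.R x) (S.R z))]
  · intro z x
    change |S.D z - 0| ≤ _
    rw [sub_zero, abs_of_nonneg (S.D_nonneg z), add_comm, ← min_add_add_right]
    refine le_min ?_ ?_
    · rw [S.d_comm]
      exact S.D_le z x
    · have := S.D_le z (S.R x)
      rw [S.D_R, S.d_comm] at this
      linarith [S.D_nonneg x]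
  · rintro (x | x)
    · refine ⟨.inr x, ?_⟩
      change S.D x + min (S.d x x) (S.d (S.R x) x) ≤ S.D x
      linarith [min_le_left (S.d x x) (S.d (S.R x) x), S.d_self x]
    · refine ⟨.inr x, ?_⟩
      change e x x ≤ 0
      simp [e]

/-- A structure in which `D` is the attained distance from the image comes from a `1`-Lipschitz
retraction of a metric space. -/
theorem exists_realization {Z : Type} [Finite Z] (W : RetractStructure Z)
    (hW : ∀ z, ∃ w, W.d z (W.R w) ≤ W.D z) :
    ∃ (X : Type) (_ : MetricSpace X) (_ : Finite X) (R : X → X) (π : Z → X), IsLipRetraction R ∧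
      (∀ z w, dist (π z) (π w) = W.d z w) ∧ (∀ z, R (π z) = π (W.R z)) ∧
      ∀ z, distRange R (π z) = W.D z := by
  let _ : PseudoMetricSpace Z :=
    { dist := W.d
      dist_self := W.d_self
      dist_comm := W.d_comm
      dist_triangle := W.d_triangle }
  have hlip : LipschitzWith 1 W.R := LipschitzWith.of_dist_le_mul fun x y => by
    rw [NNReal.coe_one, one_mul]
    exact W.d_R_le x y
  let R : SeparationQuotient Z → SeparationQuotient Z :=
    SeparationQuotient.lift (fun z => SeparationQuotient.mk (W.R z)) fun x y h =>
      SeparationQuotient.mk_eq_mk.2 (h.map hlip.continuous)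
  have hfin : Finite (SeparationQuotient Z) := Quotient.finite _
  refine ⟨SeparationQuotient Z, inferInstance, hfin, R, SeparationQuotient.mk, ⟨?_, ?_⟩,
    fun _ _ => rfl, fun _ => rfl, fun z => le_antisymm ?_ ?_⟩
  · refine LipschitzWith.of_dist_le_mul fun x y => ?_
    obtain ⟨x, rfl⟩ := SeparationQuotient.surjective_mk x
    obtain ⟨y, rfl⟩ := SeparationQuotient.surjective_mk y
    rw [NNReal.coe_one, one_mul]
    exact W.d_R_le x y
  · intro x
    obtain ⟨x, rfl⟩ := SeparationQuotient.surjective_mk x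
    exact congrArg SeparationQuotient.mk (W.R_R x)
  · obtain ⟨w, hw⟩ := hW z
    exact (Metric.infDist_le_dist_of_mem
      (mem_range_self (f := R) (SeparationQuotient.mk w))).trans hw
  · refine (Metric.le_infDist ⟨_, mem_range_self (SeparationQuotient.mk z)⟩).2 ?_
    rintro _ ⟨y, rfl⟩
    obtain ⟨y, rfl⟩ := SeparationQuotient.surjective_mk y
    have := W.D_le z (W.R y)
    rw [W.D_R, add_zero] at this
    exact this

end RetractStructure

/-! ### Exact and approximate extension properties -/

section Approx

variable {𝕌 : Type*} [MetricSpace 𝕌]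

/-- The restriction of `j` to `A` is an embedding of the structure `S` into `𝕌` with the retraction
`U`, up to an error of `δ`. -/
structure ApproxEmbeds {X : Type*} (U : 𝕌 → 𝕌) (S : RetractStructure X) (A : Set X) (j : X → 𝕌)
    (δ : ℝ) : Prop where
  abs_dist : ∀ a ∈ A, ∀ b ∈ A, |dist (j a) (j b) - S.d a b| ≤ δ
  dist_R : ∀ a ∈ A, dist (j (S.R a)) (U (j a)) ≤ δ
  abs_D : ∀ a ∈ A, |distRange U (j a) - S.D a| ≤ δ

/-- The extension property for finite structures. -/
def HasExtension (U : 𝕌 → 𝕌) : Prop :=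
  ∀ (n : ℕ) (S : RetractStructure (Fin n)) (A : Set (Fin n)), MapsTo S.R A A →
    ∀ j : Fin n → 𝕌, ApproxEmbeds U S A j 0 →
      ∃ k, ApproxEmbeds U S univ k 0 ∧ ∀ a ∈ A, k a = j a

/-- The approximate extension property for finite structures. -/
def HasApproxExtension (U : 𝕌 → 𝕌) : Prop :=
  ∀ (n : ℕ) (S : RetractStructure (Fin n)) (A : Set (Fin n)), MapsTo S.R A A →
    ∀ (j : Fin n → 𝕌) (δ η : ℝ), 0 < δ → 0 < η → ApproxEmbeds U S A j δ →
      ∃ k, ApproxEmbeds U S univ k η ∧ ∀ a ∈ A, dist (k a) (j a) ≤ 5 * δ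

/-- If `j` is an embedding of `A` up to an error of `δ`, then a map near `j` is an embedding of the
whole structure up to an error less than `η`. -/
def StrictExtends {X : Type*} (U : 𝕌 → 𝕌) (S : RetractStructure X) (A : Set X) (j : X → 𝕌)
    (δ η : ℝ) : Prop :=
  ApproxEmbeds U S A j δ → ∃ k : X → 𝕌, (∀ a b, |dist (k a) (k b) - S.d a b| < η) ∧
    (∀ a, dist (k (S.R a)) (U (k a)) < η) ∧ (∀ a, |distRange U (k a) - S.D a| < η) ∧
    ∀ a ∈ A, dist (k a) (j a) < 4 * δ

variable {U : 𝕌 → 𝕌}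

namespace ApproxEmbeds

variable {X : Type*} {S : RetractStructure X} {A : Set X} {j : X → 𝕌} {δ : ℝ}

theorem dist_eq (h : ApproxEmbeds U S A j 0) {a b : X} (ha : a ∈ A) (hb : b ∈ A) :
    dist (j a) (j b) = S.d a b :=
  sub_eq_zero.1 (abs_nonpos_iff.1 (h.abs_dist a ha b hb))

theorem R_eq (h : ApproxEmbeds U S A j 0) {a : X} (ha : a ∈ A) : j (S.R a) = U (j a) :=
  dist_le_zero.1 (h.dist_R a ha)

theorem D_eq (h : ApproxEmbeds U S A j 0) {a : X} (ha : a ∈ A) : distRange U (j a) = S.D a :=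
  sub_eq_zero.1 (abs_nonpos_iff.1 (h.abs_D a ha))

theorem of_eq (h₁ : ∀ a ∈ A, ∀ b ∈ A, dist (j a) (j b) = S.d a b)
    (h₂ : ∀ a ∈ A, j (S.R a) = U (j a)) (h₃ : ∀ a ∈ A, distRange U (j a) = S.D a) :
    ApproxEmbeds U S A j 0 where
  abs_dist a ha b hb := by simp [h₁ a ha b hb]
  dist_R a ha := by simp [h₂ a ha]
  abs_D a ha := by simp [h₃ a ha]

theorem mono (h : ApproxEmbeds U S A j δ) {ε : ℝ} (hε : δ ≤ ε) : ApproxEmbeds U S A j ε where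
  abs_dist a ha b hb := (h.abs_dist a ha b hb).trans hε
  dist_R a ha := (h.dist_R a ha).trans hε
  abs_D a ha := (h.abs_D a ha).trans hε

theorem comp_inl {Z : Type*} {W : RetractStructure (X ⊕ Z)}
    (hd : ∀ x y, W.d (.inl x) (.inl y) = S.d x y) (hR : ∀ x, W.R (.inl x) = .inl (S.R x))
    (hD : ∀ x, W.D (.inl x) = S.D x) {k : X ⊕ Z → 𝕌} (h : ApproxEmbeds U W univ k δ) :
    ApproxEmbeds U S univ (fun x => k (.inl x)) δ where
  abs_dist a _ b _ := by simpa only [hd] using h.abs_dist (.inl a) (mem_univ _) (.inl b) (mem_univ _)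
  dist_R a _ := by simpa only [hR] using h.dist_R (.inl a) (mem_univ _)
  abs_D a _ := by simpa only [hD] using h.abs_D (.inl a) (mem_univ _)

end ApproxEmbeds

section Transport

variable {I : Type*} [Finite I] (S : RetractStructure I) (A : Set I)

/-- The extension properties quantify over `Fin n`, which keeps the data countable; this transports
them to arbitrary finite types such as the sums produced by amalgamation. -/
theorem exists_fin_model : ∃ (n : ℕ) (e : Fin n ≃ I) (S' : RetractStructure (Fin n)),
    (MapsTo S.R A A → MapsTo S'.R (e ⁻¹' A) (e ⁻¹' A)) ∧
    (∀ (U : 𝕌 → 𝕌) (j : I → 𝕌) (δ : ℝ), ApproxEmbeds U S A j δ →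
      ApproxEmbeds U S' (e ⁻¹' A) (j ∘ e) δ) ∧
    ∀ (U : 𝕌 → 𝕌) (k : Fin n → 𝕌) (δ : ℝ), ApproxEmbeds U S' univ k δ →
      ApproxEmbeds U S univ (k ∘ e.symm) δ := by
  obtain ⟨n, ⟨e⟩⟩ := Finite.exists_equiv_fin I
  refine ⟨n, e.symm, S.comap e.symm (fun x => e (S.R (e.symm x))) (by simp [S.R_R]) (by simp),
    fun h x hx => ?_, fun U j δ h => ⟨?_, ?_, ?_⟩, fun U k δ h => ⟨?_, ?_, ?_⟩⟩
  · simpa using h hx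
  · intro a ha b hb
    exact h.abs_dist _ ha _ hb
  · intro a ha
    simpa using h.dist_R _ ha
  · intro a ha
    exact h.abs_D _ ha
  · intro a _ b _
    simpa using h.abs_dist (e a) (mem_univ _) (e b) (mem_univ _)
  · intro a _
    simpa using h.dist_R (e a) (mem_univ _)
  · intro a _
    simpa using h.abs_D (e a) (mem_univ _)

variable {S A}

theorem HasExtension.exists_extension (h : HasExtension U) (hA : MapsTo S.R A A) {j : I → 𝕌}
    (hj : ApproxEmbeds U S A j 0) : ∃ k, ApproxEmbeds U S univ k 0 ∧ ∀ a ∈ A, k a = j a := by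
  obtain ⟨n, e, S', h₁, h₂, h₃⟩ := exists_fin_model (𝕌 := 𝕌) S A
  obtain ⟨k, hk, hkj⟩ := h n S' _ (h₁ hA) _ (h₂ U j 0 hj)
  exact ⟨_, h₃ U k 0 hk, fun a ha => by simpa using hkj (e.symm a) (by simpa using ha)⟩

theorem HasApproxExtension.exists_extension (h : HasApproxExtension U) (hA : MapsTo S.R A A)
    {j : I → 𝕌} {δ η : ℝ} (hδ : 0 < δ) (hη : 0 < η) (hj : ApproxEmbeds U S A j δ) :
    ∃ k, ApproxEmbeds U S univ k η ∧ ∀ a ∈ A, dist (k a) (j a) ≤ 5 * δ := by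
  obtain ⟨n, e, S', h₁, h₂, h₃⟩ := exists_fin_model (𝕌 := 𝕌) S A
  obtain ⟨k, hk, hkj⟩ := h n S' _ (h₁ hA) _ δ η hδ hη (h₂ U j δ hj)
  exact ⟨_, h₃ U k η hk, fun a ha => by simpa using hkj (e.symm a) (by simpa using ha)⟩

end Transport

theorem abs_sub_dist_le_of_dist_le {x x' y y' : 𝕌} {s α β γ : ℝ} (h : |dist x y - s| ≤ α)
    (hx : dist x x' ≤ β) (hy : dist y y' ≤ γ) : |dist x' y' - s| ≤ α + β + γ := by
  have h₁ := abs_le.1 h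
  have h₂ := abs_le.1 (dist_dist_dist_le x y x' y')
  exact abs_le.2 ⟨by linarith, by linarith⟩

/-- A finite structure `S` can be amalgamated with a finite part of `𝕌`, along an embedding `j` of
`A₀` and an approximate embedding `f` of `A₁`. -/
theorem exists_amalgam (hU : IsLipRetraction U) {B : Type} [Finite B] (S : RetractStructure B)
    {A₀ A₁ : Set B} (h₀ : MapsTo S.R A₀ A₀) (h₁ : MapsTo S.R A₁ A₁) {j f : B → 𝕌} {δ : ℝ}
    (hδ : 0 ≤ δ) (hj : ApproxEmbeds U S A₀ j 0) (hf : ApproxEmbeds U S A₁ f δ)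
    (hjf : ∀ a ∈ A₀, ∀ b ∈ A₁, |dist (j a) (f b) - S.d a b| ≤ 2 * δ) :
    ∃ (Z : Type) (_ : Finite Z) (W : RetractStructure (B ⊕ Z)) (J : B ⊕ Z → 𝕌),
      ApproxEmbeds U W (range Sum.inr) J 0 ∧
      MapsTo W.R (range Sum.inr) (range Sum.inr) ∧
      (∀ x y, W.d (.inl x) (.inl y) = S.d x y) ∧ (∀ x, W.R (.inl x) = .inl (S.R x)) ∧
      (∀ x, W.D (.inl x) = S.D x) ∧
      (∀ a ∈ A₀, ∃ z, J (.inr z) = j a ∧ W.d (.inl a) (.inr z) ≤ 0) ∧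
      ∀ b ∈ A₁, ∃ z, J (.inr z) = f b ∧ W.d (.inl b) (.inr z) ≤ 3 * δ := by
  -- The second copy of `A₁` carries the points `U (f b)`: since `f (S.R b)` is only close to `U (f
  -- b)`, they must be added to obtain a set closed under `U`.
  let ρ : A₀ ⊕ (A₁ ⊕ A₁) → A₀ ⊕ (A₁ ⊕ A₁) :=
    Sum.elim (fun a => .inl ⟨S.R a, h₀ a.2⟩)
      (Sum.elim (fun b => .inr (.inr b)) (fun b => .inr (.inr b)))
  let Ψ : A₀ ⊕ (A₁ ⊕ A₁) → 𝕌 :=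
    Sum.elim (fun a => j a) (Sum.elim (fun b => f b) (fun b => U (f b)))
  let Φ : A₀ ⊕ (A₁ ⊕ A₁) → B :=
    Sum.elim (fun a => a) (Sum.elim (fun b => b) (fun b => S.R b))
  -- The weight `3 * δ` is the error between `j a` and `U (f b)`: `2 * δ` from `hjf` and `δ` for
  -- replacing `f (S.R b)` by `U (f b)`.
  let w : A₀ ⊕ (A₁ ⊕ A₁) → ℝ := Sum.elim (fun _ => 0) (fun _ => 3 * δ)
  have hρ : ∀ z, ρ (ρ z) = ρ z := by
    rintro (a | b | b)
    · simp [ρ, S.R_R]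
    · rfl
    · rfl
  have hΨ : ∀ z, Ψ (ρ z) = U (Ψ z) := by
    rintro (a | b | b)
    · exact hj.R_eq a.2
    · rfl
    · exact (hU.2 _).symm
  have hRf : ∀ b ∈ A₁, dist (f (S.R b)) (U (f b)) ≤ δ := hf.dist_R
  have hab : ∀ a ∈ A₀, ∀ b ∈ A₁, |dist (j a) (U (f b)) - S.d a (S.R b)| ≤ 3 * δ := by
    intro a ha b hb
    refine (abs_sub_dist_le_of_dist_le (hjf a ha _ (h₁ hb)) (dist_self (j a)).le
      (hRf b hb)).trans ?_
    linarith
  have hbb : ∀ b ∈ A₁, ∀ b' ∈ A₁, |dist (f b) (U (f b')) - S.d b (S.R b')| ≤ 6 * δ := by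
    intro b hb b' hb'
    refine (abs_sub_dist_le_of_dist_le (hf.abs_dist b hb _ (h₁ hb')) (dist_self (f b)).le
      (hRf b' hb')).trans ?_
    linarith
  have hRR : ∀ b ∈ A₁, ∀ b' ∈ A₁,
      |dist (U (f b)) (U (f b')) - S.d (S.R b) (S.R b')| ≤ 6 * δ := by
    intro b hb b' hb'
    refine (abs_sub_dist_le_of_dist_le (hf.abs_dist _ (h₁ hb) _ (h₁ hb')) (hRf b hb)
      (hRf b' hb')).trans ?_
    linarith
  let T : RetractStructure (A₀ ⊕ (A₁ ⊕ A₁)) := hU.toStructure.comap Ψ ρ hρ hΨ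
  obtain ⟨W, hW₁, hW₂, hW₃, hW₄, hW₅, hW₆, hW₇⟩ := S.exists_glue T Φ w
    (by
      rintro (a | b | b)
      · rfl
      · rfl
      · exact (S.R_R _).symm)
    (by rintro (a | b | b) <;> exact le_rfl)
    (by
      intro p q
      rw [abs_sub_comm]
      change |dist (Ψ p) (Ψ q) - _| ≤ _
      rcases p with a | b | b <;> rcases q with a' | b' | b' <;>
        simp only [Ψ, Φ, w, Sum.elim_inl, Sum.elim_inr]
      · simpa using hj.abs_dist a a.2 a' a'.2
      · exact (hjf a a.2 b' b'.2).trans (by linarith)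
      · exact (hab a a.2 b' b'.2).trans (by linarith)
      · rw [dist_comm, S.d_comm]
        exact (hjf a' a'.2 b b.2).trans (by linarith)
      · exact (hf.abs_dist b b.2 b' b'.2).trans (by linarith)
      · exact (hbb b b.2 b' b'.2).trans (by linarith)
      · rw [dist_comm, S.d_comm]
        exact (hab a' a'.2 b b.2).trans (by linarith)
      · rw [dist_comm, S.d_comm]
        exact (hbb b' b'.2 b b.2).trans (by linarith)
      · exact (hRR b b.2 b' b'.2).trans (by linarith))
    (by
      intro p
      rw [abs_sub_comm]
      change |distRange U (Ψ p) - _| ≤ _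
      rcases p with a | b | b <;> simp only [Ψ, Φ, w, Sum.elim_inl, Sum.elim_inr]
      · exact hj.abs_D a a.2
      · exact (hf.abs_D b b.2).trans (by linarith)
      · rw [S.D_R, distRange_self]
        simpa using hδ)
  refine ⟨A₀ ⊕ (A₁ ⊕ A₁), inferInstance, W, Sum.elim j Ψ, .of_eq ?_ ?_ ?_, ?_, hW₁, hW₃, hW₅,
    fun a ha => ⟨.inl ⟨a, ha⟩, rfl, hW₇ (.inl ⟨a, ha⟩)⟩,
    fun b hb => ⟨.inr (.inl ⟨b, hb⟩), rfl, hW₇ (.inr (.inl ⟨b, hb⟩))⟩⟩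
  · rintro _ ⟨z, rfl⟩ _ ⟨z', rfl⟩
    exact (hW₂ z z').symm
  · rintro _ ⟨z, rfl⟩
    rw [hW₄]
    exact hΨ z
  · rintro _ ⟨z, rfl⟩
    exact (hW₆ z).symm
  · rintro _ ⟨z, rfl⟩
    exact ⟨_, (hW₄ z).symm⟩

/-- Amalgamate `S` with the image of `j` and extend exactly over the amalgam. The new copy of `A` is
within `3 * δ` of `j`, which leaves room for the strict bound `4 * δ`. -/
theorem HasExtension.strictExtends (hU : IsLipRetraction U) (h : HasExtension U) {n : ℕ}
    (S : RetractStructure (Fin n)) {A : Set (Fin n)} (hA : MapsTo S.R A A) (j : Fin n → 𝕌)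
    {δ η : ℝ} (hδ : 0 < δ) (hη : 0 < η) : StrictExtends U S A j δ η := by
  intro hj
  obtain ⟨Z, _, W, J, hJ, hWR, hW₁, hW₂, hW₃, -, hW₄⟩ :=
    exists_amalgam hU S (mapsTo_empty _ _) hA (j := j) hδ.le
      ⟨by simp, by simp, by simp⟩ hj (by simp)
  obtain ⟨k, hk, hkJ⟩ := h.exists_extension hWR hJ
  have hk' := hk.comp_inl hW₁ hW₂ hW₃
  refine ⟨fun x => k (.inl x), fun a b => (hk'.abs_dist a (mem_univ _) b (mem_univ _)).trans_lt hη,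
    fun a => (hk'.dist_R a (mem_univ _)).trans_lt hη,
    fun a => (hk'.abs_D a (mem_univ _)).trans_lt hη, fun a ha => ?_⟩
  obtain ⟨z, hz, hz'⟩ := hW₄ a ha
  rw [← hz, ← hkJ _ (mem_range_self z), hk.dist_eq (mem_univ _) (mem_univ _)]
  linarith

/-- Amalgamating over both the exact `j` on `A` and the approximate `k` on everything gives a better
approximation that stays close to the previous one, so that iteration converges. -/
theorem HasApproxExtension.refine (hU : IsLipRetraction U) (h : HasApproxExtension U) {n : ℕ}
    {S : RetractStructure (Fin n)} {A : Set (Fin n)} (hA : MapsTo S.R A A) {j : Fin n → 𝕌}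
    (hj : ApproxEmbeds U S A j 0) {k : Fin n → 𝕌} {η η' : ℝ} (hη : 0 < η) (hη' : 0 < η')
    (hk : ApproxEmbeds U S univ k η) (hkj : ∀ a ∈ A, dist (k a) (j a) ≤ η) :
    ∃ k', (ApproxEmbeds U S univ k' η' ∧ ∀ a ∈ A, dist (k' a) (j a) ≤ η') ∧
      ∀ b, dist (k' b) (k b) ≤ 3 * η + η' := by
  obtain ⟨Z, _, W, J, hJ, hWR, hW₁, hW₂, hW₃, hW₄, hW₅⟩ :=
    exists_amalgam hU S hA (mapsTo_univ _ _) hη.le hj hk (by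
      intro a ha b _
      refine (abs_sub_dist_le_of_dist_le (hk.abs_dist a (mem_univ _) b (mem_univ _))
        (hkj a ha) (dist_self (k b)).le).trans ?_
      linarith)
  -- The total error is `η' / 2 + 5 * (η' / 16)`, below `η'`.
  obtain ⟨K, hK, hKJ⟩ := h.exists_extension hWR (δ := η' / 16) (η := η' / 2) (by positivity)
    (by positivity) (hJ.mono (by positivity))
  have key : ∀ b z, dist (K (.inl b)) (J (.inr z)) ≤ W.d (.inl b) (.inr z) + η' := fun b z => by
    have h₁ := (abs_le.1 (hK.abs_dist (.inl b) (mem_univ _) (.inr z) (mem_univ _))).2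
    have h₂ := hKJ _ (mem_range_self z)
    have h₃ := dist_triangle (K (.inl b)) (K (.inr z)) (J (.inr z))
    linarith
  refine ⟨fun x => K (.inl x), ⟨(hK.comp_inl hW₁ hW₂ hW₃).mono (by linarith), fun a ha => ?_⟩,
    fun b => ?_⟩
  · obtain ⟨z, hz, hz'⟩ := hW₄ a ha
    rw [← hz]
    linarith [key a z]
  · obtain ⟨z, hz, hz'⟩ := hW₅ b (mem_univ _)
    rw [← hz]
    linarith [key b z]

theorem HasApproxExtension.hasExtension [CompleteSpace 𝕌] (hU : IsLipRetraction U)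
    (h : HasApproxExtension U) : HasExtension U := by
  intro n S A hA j hj
  let P : ℕ → (Fin n → 𝕌) → Prop := fun m k =>
    ApproxEmbeds U S univ k ((1 / 2) ^ m) ∧ ∀ a ∈ A, dist (k a) (j a) ≤ (1 / 2) ^ m
  have hstep : ∀ m k, P m k → ∃ k', P (m + 1) k' ∧
      ∀ b, dist (k' b) (k b) ≤ 3 * (1 / 2) ^ m + (1 / 2) ^ (m + 1) := fun m k hk =>
    h.refine hU hA hj (by positivity) (by positivity) hk.1 hk.2
  choose! F hF hF' using hstep
  -- With `δ = 1 / 5` the displacement bound `5 * δ` is `1 = (1 / 2) ^ 0`, as `P 0` requires.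
  obtain ⟨k₀, hk₀, hk₀j⟩ := h n S A hA j (1 / 5) 1 (by norm_num) one_pos (hj.mono (by norm_num))
  let s : ℕ → Fin n → 𝕌 := fun m => Nat.rec k₀ (fun m k => F m k) m
  have hs : ∀ m, P m (s m) := by
    intro m
    induction m with
    | zero =>
      change P 0 k₀
      exact ⟨by simpa using hk₀, fun a ha => by simpa using hk₀j a ha⟩
    | succ m ih => exact hF m _ ih
  have hcau : ∀ b, ∃ y, Filter.Tendsto (fun m => s m b) Filter.atTop (𝓝 y) := fun b => by
    refine cauchySeq_tendsto_of_complete (cauchySeq_of_le_geometric (1 / 2) 4 (by norm_num) ?_)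
    intro m
    rw [dist_comm]
    refine (hF' m _ (hs m) b).trans ?_
    have : (0 : ℝ) < (1 / 2) ^ m := by positivity
    rw [pow_succ]
    linarith
  choose k hk using hcau
  have hpow : Filter.Tendsto (fun m : ℕ => ((1 : ℝ) / 2) ^ m) Filter.atTop (𝓝 0) :=
    tendsto_pow_atTop_nhds_zero_of_lt_one (by norm_num) (by norm_num)
  refine ⟨k, ⟨fun a _ b _ => ?_, fun a _ => ?_, fun a _ => ?_⟩, fun a ha => ?_⟩
  · exact le_of_tendsto_of_tendsto' (((hk a).dist (hk b)).sub_const _).abs hpow fun m =>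
      (hs m).1.abs_dist a (mem_univ _) b (mem_univ _)
  · exact le_of_tendsto_of_tendsto' ((hk _).dist ((hU.1.continuous.tendsto _).comp (hk a))) hpow
      fun m => (hs m).1.dist_R a (mem_univ _)
  · exact le_of_tendsto_of_tendsto'
      ((((continuous_distRange U).tendsto _).comp (hk a)).sub_const _).abs hpow
      fun m => (hs m).1.abs_D a (mem_univ _)
  · exact dist_le_zero.1 (le_of_tendsto_of_tendsto' ((hk a).dist tendsto_const_nhds) hpow
      fun m => (hs m).2 a ha)

theorem exists_countable_dist_lt {α E : Type*} [PseudoMetricSpace E] [SecondCountableTopology E]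
    (f : α → E) : ∃ T : Set α, T.Countable ∧ ∀ a, ∀ ε > 0, ∃ t ∈ T, dist (f t) (f a) < ε := by
  obtain ⟨D, hD, hD'⟩ := TopologicalSpace.exists_countable_dense (range f)
  choose g hg using fun x : range f => x.2
  refine ⟨g '' D, hD.image g, fun a ε hε => ?_⟩
  obtain ⟨x, hx, hx'⟩ := hD'.exists_dist_lt ⟨f a, mem_range_self a⟩ hε
  refine ⟨g x, mem_image_of_mem g hx, ?_⟩
  rw [hg, dist_comm]
  exact hx'

/-- For each of the finitely many maps `ρ`, the structures with retraction `ρ` are determined by a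
point of a finite-dimensional space. The dense set is chosen among the structures themselves, so its
members satisfy the axioms. -/
theorem exists_countable_dense_structures (n : ℕ) : ∃ T : Set (RetractStructure (Fin n)),
    T.Countable ∧ ∀ S : RetractStructure (Fin n), ∀ ε > 0, ∃ S' ∈ T, S'.R = S.R ∧
      (∀ a b, |S'.d a b - S.d a b| < ε) ∧ ∀ a, |S'.D a - S.D a| < ε := by
  have H : ∀ ρ : Fin n → Fin n, ∃ T : Set {S : RetractStructure (Fin n) // S.R = ρ},
      T.Countable ∧ ∀ a : {S : RetractStructure (Fin n) // S.R = ρ}, ∀ ε > 0, ∃ t ∈ T,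
        dist (t.1.d, t.1.D) (a.1.d, a.1.D) < ε := fun ρ =>
    exists_countable_dist_lt fun S : {S : RetractStructure (Fin n) // S.R = ρ} => (S.1.d, S.1.D)
  choose T hT hT' using H
  refine ⟨⋃ ρ, Subtype.val '' T ρ, countable_iUnion fun ρ => (hT ρ).image _, fun S ε hε => ?_⟩
  obtain ⟨t, ht, htε⟩ := hT' S.R ⟨S, rfl⟩ ε hε
  rw [Prod.dist_eq, max_lt_iff] at htε
  refine ⟨t.1, mem_iUnion.2 ⟨S.R, mem_image_of_mem _ ht⟩, t.2, fun a b => ?_, fun a => ?_⟩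
  · exact ((dist_le_pi_dist (t.1.d a) (S.d a) b).trans (dist_le_pi_dist t.1.d S.d a)).trans_lt htε.1
  · exact (dist_le_pi_dist t.1.D S.D a).trans_lt htε.2

theorem HasApproxExtension.of_strictExtends (hU : IsLipRetraction U)
    {T : ∀ n, Set (RetractStructure (Fin n))}
    (hT : ∀ n, ∀ S : RetractStructure (Fin n), ∀ ε > 0, ∃ S' ∈ T n, S'.R = S.R ∧
      (∀ a b, |S'.d a b - S.d a b| < ε) ∧ ∀ a, |S'.D a - S.D a| < ε)
    {q : ℕ → 𝕌} (hq : DenseRange q)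
    (h : ∀ n, ∀ S ∈ T n, ∀ A : Set (Fin n), MapsTo S.R A A → ∀ i : Fin n → ℕ, ∀ δ η : ℚ,
      0 < δ → 0 < η → StrictExtends U S A (fun a => q (i a)) δ η) : HasApproxExtension U := by
  intro n S A hA j δ η hδ hη hj
  obtain ⟨δ', hδ', hδ''⟩ := exists_rat_btwn (show δ < δ + δ / 16 by linarith)
  obtain ⟨η', hη', hη''⟩ := exists_rat_btwn (half_pos hη)
  -- Perturbing `S` and `j` by `θ` must fit both into the gap `δ' - δ` and into the half of `η` left
  -- by `η'`. As `δ'` is at most slightly above `δ`, the bound `4 * δ' + θ` remains below `5 * δ`.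
  set θ : ℝ := min ((δ' - δ) / 4) (η / 4)
  have hθ₁ : θ ≤ (δ' - δ) / 4 := min_le_left _ _
  have hθ₂ : θ ≤ η / 4 := min_le_right _ _
  have hθ₀ : 0 < θ := lt_min (by linarith) (by linarith)
  obtain ⟨S', hS', hSR, hSd, hSD⟩ := hT n S θ hθ₀
  choose i hi using fun a => hq.exists_dist_lt (j a) hθ₀
  have hj' : ApproxEmbeds U S' A (fun a => q (i a)) δ' := by
    refine ⟨?_, ?_, ?_⟩
    · intro a ha b hb
      have h₁ := abs_le.1 (abs_sub_dist_le_of_dist_le (hj.abs_dist a ha b hb) (hi a).le (hi b).le)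
      have h₂ := abs_lt.1 (hSd a b)
      exact abs_le.2 ⟨by linarith, by linarith⟩
    · intro a ha
      rw [hSR]
      have h₁ := hj.dist_R a ha
      have h₂ := dist_triangle4_right (q (i (S.R a))) (U (q (i a))) (j (S.R a)) (U (j a))
      have h₃ := hU.dist_le (q (i a)) (j a)
      have h₄ := hi a
      have h₅ := hi (S.R a)
      rw [dist_comm] at h₄ h₅
      linarith
    · intro a ha
      have h₁ := abs_le.1 (hj.abs_D a ha)
      have h₂ := abs_lt.1 (hSD a)
      have h₃ := distRange_le U (j a) (q (i a))
      have h₄ := distRange_le U (q (i a)) (j a)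
      have h₅ := hi a
      rw [dist_comm] at h₄
      exact abs_le.2 ⟨by linarith, by linarith⟩
  obtain ⟨k, hk₁, hk₂, hk₃, hk₄⟩ := h n S' hS' A (by rwa [hSR]) i δ' η'
    (by exact_mod_cast hδ.trans hδ') (by exact_mod_cast hη') hj'
  refine ⟨k, ⟨fun a _ b _ => ?_, fun a _ => ?_, fun a _ => ?_⟩, fun a ha => ?_⟩
  · have h₁ := abs_lt.1 (hk₁ a b)
    have h₂ := abs_lt.1 (hSd a b)
    exact abs_le.2 ⟨by linarith, by linarith⟩
  · have h₁ := hk₂ a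
    rw [hSR] at h₁
    linarith
  · have h₁ := abs_lt.1 (hk₃ a)
    have h₂ := abs_lt.1 (hSD a)
    exact abs_le.2 ⟨by linarith, by linarith⟩
  · have h₁ := hk₄ a ha
    have h₂ := hi a
    have h₃ := dist_triangle_right (k a) (j a) (q (i a))
    linarith

theorem exists_isometryEquiv_range {ι : Type*} {f g : ι → 𝕌}
    (h : ∀ a b, dist (f a) (f b) = dist (g a) (g b)) :
    ∃ i : range f ≃ᵢ range g, ∀ a, (i ⟨f a, mem_range_self a⟩ : 𝕌) = g a := by
  choose s hs using fun x : range f => x.2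
  have hiso : Isometry fun x : range f => (⟨g (s x), mem_range_self _⟩ : range g) :=
    Isometry.of_dist_eq fun x y => by
      rw [Subtype.dist_eq, Subtype.dist_eq, ← h, hs, hs]
  have hval : ∀ a, g (s ⟨f a, mem_range_self a⟩) = g a := fun a => by
    rw [← dist_eq_zero, ← h, hs, dist_self]
  refine ⟨⟨Equiv.ofBijective _ ⟨hiso.injective, ?_⟩, hiso⟩, hval⟩
  rintro ⟨_, a, rfl⟩
  exact ⟨⟨f a, mem_range_self a⟩, Subtype.ext (hval a)⟩

/-- Universality supplies some copy of the whole structure; on `A` it differs from `j` by an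
isomorphism of finite substructures, which ultrahomogeneity extends to an automorphism carrying the
copy onto an extension of `j`. -/
theorem IsUniversalRetraction.hasExtension (hU : IsUniversalRetraction U)
    (hU' : IsUltrahomogeneousRetraction U) : HasExtension U := by
  intro n S A hA j hj
  obtain ⟨W, hW₁, hW₂, hW₃, hW₄⟩ := S.exists_attained
  obtain ⟨X, _, _, R, π, hR, hπ, hπR, hπD⟩ := W.exists_realization hW₄
  obtain ⟨e, he, heR⟩ := hU X R hR
  have hf : ApproxEmbeds U W univ (fun z => e (π z)) 0 := by
    refine .of_eq (fun a _ b _ => ?_) (fun a _ => ?_) (fun a _ => ?_)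
    · rw [he.dist_eq, hπ]
    · rw [← (heR _).1, hπR]
    · rw [← (heR _).2, hπD]
  replace hf := hf.comp_inl hW₁ hW₂ hW₃
  set f : Fin n → 𝕌 := fun x => e (π (.inl x))
  obtain ⟨i, hi⟩ := exists_isometryEquiv_range (f := fun a : A => f a) (g := fun a : A => j a)
    fun a b => by rw [hf.dist_eq (mem_univ _) (mem_univ _), hj.dist_eq a.2 b.2]
  have hfU : ∀ a : A, U (f a) = f (S.R a) := fun a => (hf.R_eq (mem_univ _)).symm
  have hmaps : MapsTo U (range fun a : A => f a) (range fun a : A => f a) := by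
    rintro _ ⟨a, rfl⟩
    exact ⟨⟨S.R a, hA a.2⟩, (hfU a).symm⟩
  obtain ⟨I, hI, hIU, hID⟩ := hU' _ _ (finite_range _) (finite_range _) hmaps i
    (by
      rintro ⟨_, a, rfl⟩
      have : (⟨U (f a), hmaps (mem_range_self a)⟩ : range fun a : A => f a) =
        ⟨f (⟨S.R a, hA a.2⟩ : A), mem_range_self _⟩ := Subtype.ext (hfU a)
      rw [this, hi, hi]
      exact hj.R_eq a.2)
    (by
      rintro ⟨_, a, rfl⟩
      rw [hi, hj.D_eq a.2]
      exact hf.D_eq (mem_univ _))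
  refine ⟨fun x => I (f x), .of_eq (fun a _ b _ => ?_) (fun a _ => ?_) (fun a _ => ?_),
    fun a ha => ?_⟩
  · rw [I.dist_eq, hf.dist_eq (mem_univ _) (mem_univ _)]
  · rw [hf.R_eq (mem_univ _), hIU]
  · rw [← hID, hf.D_eq (mem_univ _)]
  · change I (f a) = j a
    rw [hI ⟨f a, mem_range_self (⟨a, ha⟩ : A)⟩, hi ⟨a, ha⟩]

end Approx

/-! ### Back-and-forth with partial isomorphisms -/

section PartialIso

variable {X 𝕌 : Type*} [MetricSpace X] [MetricSpace 𝕌] {R : X → X} {U : 𝕌 → 𝕌}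

/-- `P` is the graph of an isomorphism between substructures of `X` with the retraction `R` and `𝕌`
with the retraction `U`. -/
structure IsPartialIso (R : X → X) (U : 𝕌 → 𝕌) (P : Set (X × 𝕌)) : Prop where
  map_mem : ∀ p ∈ P, (R p.1, U p.2) ∈ P
  dist_eq : ∀ p ∈ P, ∀ q ∈ P, dist p.1 q.1 = dist p.2 q.2
  distRange_eq : ∀ p ∈ P, distRange R p.1 = distRange U p.2

namespace IsPartialIso

variable {P : Set (X × 𝕌)}

theorem swap (h : IsPartialIso R U P) : IsPartialIso U R (Prod.swap ⁻¹' P) where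
  map_mem _ hp := h.map_mem _ hp
  dist_eq _ hp _ hq := (h.dist_eq _ hp _ hq).symm
  distRange_eq _ hp := (h.distRange_eq _ hp).symm

theorem exists_extension [Nonempty 𝕌] (hR : IsLipRetraction R) (hU : IsLipRetraction U)
    (hE : HasExtension U) (h : IsPartialIso R U P) (hP : P.Finite) (x : X) :
    ∃ P', P'.Finite ∧ IsPartialIso R U P' ∧ P ⊆ P' ∧ x ∈ Prod.fst '' P' := by
  have : Finite P := hP
  -- `true` stands for `x` and `false` for `R x`. These may repeat points of `P`, which is harmless
  -- because structures carry only a pseudometric.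
  let f : P ⊕ Bool → X := Sum.elim (fun p => p.1.1) fun b => bif b then x else R x
  let ρ : P ⊕ Bool → P ⊕ Bool :=
    Sum.elim (fun p => .inl ⟨_, h.map_mem p.1 p.2⟩) fun _ => .inr false
  have hρ : ∀ y, ρ (ρ y) = ρ y := by
    rintro (p | b)
    · simp [ρ, hR.2, hU.2]
    · rfl
  have hf : ∀ y, f (ρ y) = R (f y) := by
    rintro (p | _ | _)
    · rfl
    · exact (hR.2 x).symm
    · rfl
  let S := hR.toStructure.comap f ρ hρ hf
  let y₀ : 𝕌 := Classical.arbitrary 𝕌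
  let j : P ⊕ Bool → 𝕌 := Sum.elim (fun p => p.1.2) fun _ => y₀
  obtain ⟨k, hk, hkj⟩ := hE.exists_extension (S := S) (A := range Sum.inl) (j := j)
    (by
      rintro _ ⟨p, rfl⟩
      exact ⟨_, rfl⟩)
    (.of_eq
      (by
        rintro _ ⟨p, rfl⟩ _ ⟨q, rfl⟩
        exact (h.dist_eq p.1 p.2 q.1 q.2).symm)
      (by
        rintro _ ⟨p, rfl⟩
        rfl)
      (by
        rintro _ ⟨p, rfl⟩
        exact (h.distRange_eq p.1 p.2).symm))
  refine ⟨range fun z => (f z, k z), finite_range _, ⟨?_, ?_, ?_⟩, fun p hp => ?_, ?_⟩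
  · rintro _ ⟨z, rfl⟩
    exact ⟨ρ z, Prod.ext (hf z) (hk.R_eq (mem_univ z))⟩
  · rintro _ ⟨z, rfl⟩ _ ⟨w, rfl⟩
    exact (hk.dist_eq (mem_univ z) (mem_univ w)).symm
  · rintro _ ⟨z, rfl⟩
    exact (hk.D_eq (mem_univ z)).symm
  · exact ⟨.inl ⟨p, hp⟩, Prod.ext rfl (hkj _ (mem_range_self _))⟩
  · exact ⟨_, ⟨.inr true, rfl⟩, rfl⟩

/-- A countable family of properties that can be achieved one at a time by extending finite partial
isomorphisms can be achieved simultaneously. -/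
theorem exists_generic {ι : Type*} [Encodable ι] (Q : ι → Set (X × 𝕌) → Prop)
    (hQ : ∀ i P, P.Finite → IsPartialIso R U P →
      ∃ P', P'.Finite ∧ IsPartialIso R U P' ∧ P ⊆ P' ∧ Q i P')
    (h : IsPartialIso R U P) (hP : P.Finite) :
    ∃ G, IsPartialIso R U G ∧ P ⊆ G ∧ ∀ i, ∃ P' ⊆ G, Q i P' := by
  let K := {P : Set (X × 𝕌) // P.Finite ∧ IsPartialIso R U P}
  let 𝒟 : ι → Order.Cofinal K := fun i =>
    { carrier := {P | Q i P.1}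
      isCofinal := fun P => by
        obtain ⟨P', h₁, h₂, h₃, h₄⟩ := hQ i P.1 P.2.1 P.2.2
        exact ⟨⟨P', h₁, h₂⟩, h₄, h₃⟩ }
  let s := Order.sequenceOfCofinals (⟨P, hP, h⟩ : K) 𝒟
  have hs : Monotone s := Order.sequenceOfCofinals.monotone _ _
  refine ⟨⋃ n, (s n).1, ⟨fun p hp => ?_, fun p hp q hq => ?_, fun p hp => ?_⟩,
    subset_iUnion (fun n => (s n).1) 0, fun i =>
      ⟨_, subset_iUnion (fun n => (s n).1) _, Order.sequenceOfCofinals.encode_mem _ 𝒟 i⟩⟩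
  · obtain ⟨n, hn⟩ := mem_iUnion.1 hp
    exact mem_iUnion.2 ⟨n, (s n).2.2.map_mem p hn⟩
  · obtain ⟨n, hn⟩ := mem_iUnion.1 hp
    obtain ⟨m, hm⟩ := mem_iUnion.1 hq
    exact (s (max n m)).2.2.dist_eq p (hs (le_max_left n m) hn) q (hs (le_max_right n m) hm)
  · obtain ⟨n, hn⟩ := mem_iUnion.1 hp
    exact (s n).2.2.distRange_eq p hn

/-- Preservation of distances makes `P` the graph of an isometry on a dense set; it extends by
uniform continuity, and the identities for `R` and `distRange` pass to limits. -/
theorem exists_isometry [CompleteSpace 𝕌] (hR : IsLipRetraction R) (hU : IsLipRetraction U)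
    (h : IsPartialIso R U P) (hP : Dense (Prod.fst '' P)) :
    ∃ f : X → 𝕌, Isometry f ∧ (∀ p ∈ P, f p.1 = p.2) ∧ (∀ x, f (R x) = U (f x)) ∧
      ∀ x, distRange R x = distRange U (f x) := by
  choose g hg hg' using fun x : Prod.fst '' P => x.2
  have hiso : Isometry fun x => (g x).2 := Isometry.of_dist_eq fun x y => by
    rw [← h.dist_eq _ (hg x) _ (hg y), hg', hg', Subtype.dist_eq]
  have hind : IsUniformInducing (Subtype.val : Prod.fst '' P → X) := isUniformInducing_val _
  have hden : DenseRange (Subtype.val : Prod.fst '' P → X) := hP.denseRange_val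
  let f : X → 𝕌 := (hind.isDenseInducing hden).extend fun x => (g x).2
  have hfc : Continuous f :=
    (uniformContinuous_uniformly_extend hind hden hiso.uniformContinuous).continuous
  have hfg : ∀ x : Prod.fst '' P, f x = (g x).2 := fun x =>
    uniformly_extend_of_ind hind hden hiso.uniformContinuous x
  have hf : Isometry f := Isometry.of_dist_eq fun x y =>
    isClosed_property2 (p := fun x y => dist (f x) (f y) = dist x y) hden
      (isClosed_eq (by fun_prop) (by fun_prop))
      (fun x y => by rw [hfg, hfg]; exact hiso.dist_eq x y) x y
  have hfP : ∀ p ∈ P, f p.1 = p.2 := fun p hp => by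
    have := hfg ⟨p.1, mem_image_of_mem _ hp⟩
    rw [this, ← dist_eq_zero, ← h.dist_eq _ (hg _) _ hp, hg', dist_self]
  refine ⟨f, hf, hfP, fun x => ?_, fun x => ?_⟩
  · refine isClosed_property hden (isClosed_eq (hfc.comp hR.1.continuous)
      (hU.1.continuous.comp hfc)) ?_ x
    rintro ⟨_, p, hp, rfl⟩
    change f (R p.1) = U (f p.1)
    rw [hfP p hp, hfP _ (h.map_mem p hp)]
  · refine isClosed_property hden (isClosed_eq (continuous_distRange R)
      ((continuous_distRange U).comp hfc)) ?_ x
    rintro ⟨_, p, hp, rfl⟩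
    change distRange R p.1 = distRange U (f p.1)
    rw [hfP p hp, h.distRange_eq p hp]

theorem empty (R : X → X) (U : 𝕌 → 𝕌) : IsPartialIso R U ∅ := ⟨by simp, by simp, by simp⟩

end IsPartialIso

end PartialIso

/-! ### From the extension property to universality and ultrahomogeneity -/

section Extension

variable {𝕌 : Type*} [MetricSpace 𝕌] [CompleteSpace 𝕌] [Nonempty 𝕌] {U : 𝕌 → 𝕌}

theorem HasExtension.isUniversalRetraction (hU : IsLipRetraction U) (h : HasExtension U) :
    IsUniversalRetraction U := by
  intro X _ _ R hR
  rcases isEmpty_or_nonempty X with hX | hX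
  · exact ⟨isEmptyElim, isEmptyElim, isEmptyElim⟩
  obtain ⟨G, hG, -, hG'⟩ := (IsPartialIso.empty R U).exists_generic
    (fun n P => TopologicalSpace.denseSeq X n ∈ Prod.fst '' P)
    (fun n P hP h' => h'.exists_extension hR hU h hP _) finite_empty
  have hden : Dense (Prod.fst '' G) := (TopologicalSpace.denseRange_denseSeq X).mono (by
    rintro _ ⟨n, rfl⟩
    obtain ⟨P', hP', hn⟩ := hG' n
    exact image_mono hP' hn)
  obtain ⟨f, hf, -, hfR, hfD⟩ := hG.exists_isometry hR hU hden
  exact ⟨f, hf, fun x => ⟨hfR x, hfD x⟩⟩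

theorem HasExtension.isUltrahomogeneousRetraction [TopologicalSpace.SeparableSpace 𝕌]
    (hU : IsLipRetraction U) (h : HasExtension U) : IsUltrahomogeneousRetraction U := by
  intro A₁ A₂ hA₁ _ hA i hi hiD
  have : Finite A₁ := hA₁
  have hP : IsPartialIso U U (range fun a : A₁ => ((a : 𝕌), (i a : 𝕌))) := by
    refine ⟨?_, ?_, ?_⟩
    · rintro _ ⟨a, rfl⟩
      exact ⟨⟨U a, hA a.2⟩, Prod.ext rfl (hi a)⟩
    · rintro _ ⟨a, rfl⟩ _ ⟨b, rfl⟩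
      exact (i.dist_eq a b).symm
    · rintro _ ⟨a, rfl⟩
      exact hiD a
  -- The two copies of `ℕ` ask for density of the domain and of the range; range requests are met by
  -- extending the inverse.
  obtain ⟨G, hG, hPG, hG'⟩ := hP.exists_generic (ι := ℕ ⊕ ℕ)
    (Sum.elim (fun n P => TopologicalSpace.denseSeq 𝕌 n ∈ Prod.fst '' P)
      (fun n P => TopologicalSpace.denseSeq 𝕌 n ∈ Prod.snd '' P))
    (by
      rintro (n | n) P hP h'
      · exact h'.exists_extension hU hU h hP _
      · obtain ⟨P', h₁, h₂, h₃, p, hp, hp'⟩ := h'.swap.exists_extension hU hU h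
          (hP.preimage Prod.swap_injective.injOn) (TopologicalSpace.denseSeq 𝕌 n)
        exact ⟨Prod.swap ⁻¹' P', h₁.preimage Prod.swap_injective.injOn, h₂.swap,
          fun q hq => h₃ (show q.swap.swap ∈ P by simpa using hq), p.swap, by simpa using hp, hp'⟩)
    (finite_range _)
  have hden : Dense (Prod.fst '' G) := (TopologicalSpace.denseRange_denseSeq 𝕌).mono (by
    rintro _ ⟨n, rfl⟩
    obtain ⟨P', hP', hn⟩ := hG' (.inl n)
    exact image_mono hP' hn)
  obtain ⟨f, hf, hfG, hfR, hfD⟩ := hG.exists_isometry hU hU hden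
  have hden' : DenseRange f := (TopologicalSpace.denseRange_denseSeq 𝕌).mono (by
    rintro _ ⟨n, rfl⟩
    obtain ⟨P', hP', p, hp, hn⟩ := hG' (.inr n)
    exact ⟨p.1, (hfG p (hP' hp)).trans hn⟩)
  have hsurj : Function.Surjective f := by
    rw [← range_eq_univ, ← hf.isClosedEmbedding.isClosed_range.closure_eq]
    exact hden'.closure_eq
  exact ⟨⟨Equiv.ofBijective f ⟨hf.injective, hsurj⟩, hf⟩,
    fun a => hfG _ (hPG (mem_range_self a)), hfR, hfD⟩

end Extension

/-! ### Topological complexity of the extension conditions -/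

section StrictExtends

variable {𝕌 α X : Type*} [MetricSpace 𝕌] [TopologicalSpace α] {u : α → 𝕌 → 𝕌}

theorem isClosed_setOf_approxEmbeds (h₁ : ∀ x, Continuous fun a => u a x)
    (h₂ : ∀ x, Continuous fun a => distRange (u a) x) (S : RetractStructure X) (A : Set X)
    (j : X → 𝕌) (δ : ℝ) : IsClosed {a | ApproxEmbeds (u a) S A j δ} := by
  have : {a | ApproxEmbeds (u a) S A j δ} =
      {a | (∀ x ∈ A, ∀ y ∈ A, |dist (j x) (j y) - S.d x y| ≤ δ) ∧
        (∀ x ∈ A, dist (j (S.R x)) (u a (j x)) ≤ δ) ∧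
        ∀ x ∈ A, |distRange (u a) (j x) - S.D x| ≤ δ} :=
    Set.ext fun a => ⟨fun h => ⟨h.1, h.2, h.3⟩, fun h => ⟨h.1, h.2.1, h.2.2⟩⟩
  rw [this]
  simp only [ofPred_and, ofPred_forall]
  refine .inter (by simpa only [← ofPred_forall] using isClosed_const) (.inter ?_ ?_) <;>
    refine isClosed_iInter fun x => isClosed_iInter fun _ => isClosed_le ?_ continuous_const
  · exact continuous_const.dist (h₁ _)
  · exact ((h₂ _).sub continuous_const).abs

theorem isOpen_setOf_strictExtends [Finite X] (h₁ : ∀ x, Continuous fun a => u a x)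
    (h₂ : ∀ x, Continuous fun a => distRange (u a) x) (S : RetractStructure X) (A : Set X)
    (j : X → 𝕌) (δ η : ℝ) : IsOpen {a | StrictExtends (u a) S A j δ η} := by
  simp only [StrictExtends, imp_iff_not_or, ofPred_or, ofPred_exists]
  refine (isClosed_setOf_approxEmbeds h₁ h₂ S A j δ).isOpen_compl.union
    (isOpen_iUnion fun k => ?_)
  simp only [← imp_iff_not_or, ofPred_and]
  refine isOpen_const.inter (.inter ?_ (.inter ?_ isOpen_const)) <;>
    rw [ofPred_forall] <;>
    refine isOpen_iInter_of_finite fun x => isOpen_lt ?_ continuous_const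
  · exact continuous_const.dist (h₁ _)
  · exact ((h₂ _).sub continuous_const).abs

end StrictExtends

/-- The preimage of an open set under a pointwise limit of continuous functions is a countable
union of `Gδ` sets. -/
theorem isGδσ_preimage_of_tendsto {X Y : Type*} [TopologicalSpace X] [TopologicalSpace Y]
    [TopologicalSpace.PseudoMetrizableSpace Y] {Ψ : ℕ → X → Y} {Ψ' : X → Y}
    (hΨ : ∀ m, Continuous (Ψ m))
    (h : ∀ x, Filter.Tendsto (fun m => Ψ m x) Filter.atTop (𝓝 (Ψ' x))) {V : Set Y}
    (hV : IsOpen V) : IsGδσ (Ψ' ⁻¹' V) := by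
  let _ := TopologicalSpace.pseudoMetrizableSpacePseudoMetric Y
  -- These closed sets exhaust `V`. A limit lies in `V` exactly when some tail of the sequence lies
  -- in a single `C k`. The extended distance also covers `V = univ`.
  let C : ℕ → Set Y := fun k => {y | (k : ENNReal)⁻¹ ≤ Metric.infEDist y Vᶜ}
  have hC : ∀ k, IsClosed (C k) := fun k =>
    isClosed_le continuous_const Metric.continuous_infEDist
  have hpos : ∀ y, 0 < Metric.infEDist y Vᶜ ↔ y ∈ V := fun y => by
    rw [Metric.infEDist_pos_iff_notMem_closure, hV.isClosed_compl.closure_eq, notMem_compl_iff]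
  refine ⟨fun n => ⋂ i, Ψ (n.unpair.2 + i) ⁻¹' C n.unpair.1,
    fun n => .iInter fun i => (hC _).isGδ.preimage (hΨ _), Set.ext fun x => ?_⟩
  simp only [mem_preimage, mem_iUnion, mem_iInter]
  constructor
  · intro hx
    obtain ⟨k, hk⟩ := ENNReal.exists_inv_nat_lt ((hpos _).2 hx).ne'
    obtain ⟨N, hN⟩ := Filter.eventually_atTop.1 ((h x).eventually
      ((isOpen_lt continuous_const Metric.continuous_infEDist).mem_nhds hk))
    refine ⟨Nat.pair k N, fun i => ?_⟩
    rw [Nat.unpair_pair]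
    exact (hN (N + i) (Nat.le_add_right _ _)).le
  · rintro ⟨n, hn⟩
    have : Ψ' x ∈ C n.unpair.1 := (hC _).mem_of_tendsto (h x)
      (Filter.eventually_atTop.2 ⟨n.unpair.2, fun m hm => by
        obtain ⟨i, rfl⟩ := Nat.exists_eq_add_of_le hm
        exact hn i⟩)
    exact (hpos _).1 ((ENNReal.inv_pos.2 (ENNReal.natCast_ne_top _)).trans_le this)

/-! ### The three topologies on the set of retractions -/

namespace LipRetractions

variable {𝕌 : Type*} [MetricSpace 𝕌]

theorem continuous_apply_retractTopology (x : 𝕌) :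
    @Continuous _ _ (retractTopology 𝕌) _ fun R : LipRetractions 𝕌 => R.1 x := by
  let _ := retractTopology 𝕌
  refine continuous_def.2 fun V hV U hU => ?_
  obtain ⟨ε, hε, h⟩ := Metric.isOpen_iff.1 hV _ hU
  exact ⟨{x}, ε, hε, fun R hR => h (hR x (Finset.mem_singleton_self x)).1⟩

theorem continuous_distRange_retractTopology (x : 𝕌) :
    @Continuous _ _ (retractTopology 𝕌) _ fun R : LipRetractions 𝕌 => distRange R.1 x := by
  let _ := retractTopology 𝕌
  refine continuous_def.2 fun V hV U hU => ?_
  obtain ⟨ε, hε, h⟩ := Metric.isOpen_iff.1 hV _ hU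
  refine ⟨{x}, ε, hε, fun R hR => h ?_⟩
  rw [Metric.mem_ball, dist_comm]
  exact (hR x (Finset.mem_singleton_self x)).2

/-- The values of a retraction, and of the distance from its image, along a sequence. -/
noncomputable def retractData (q : ℕ → 𝕌) (R : LipRetractions 𝕌) (n : ℕ) : 𝕌 × ℝ :=
  (R.1 (q n), distRange R.1 (q n))

/-- Both `R` and `distRange R` are `1`-Lipschitz, so their values on a dense sequence control them
everywhere. Thus `τ_pr` is pulled back from a countable product of metric spaces. -/
theorem retractTopology_eq_induced {q : ℕ → 𝕌} (hq : DenseRange q) :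
    retractTopology 𝕌 = TopologicalSpace.induced (retractData q) inferInstance := by
  refine le_antisymm ?_ fun S hS => ?_
  · let _ := retractTopology 𝕌
    exact continuous_iff_le_induced.1 (continuous_pi fun n =>
      (continuous_apply_retractTopology (q n)).prodMk
        (continuous_distRange_retractTopology (q n)))
  let _ : TopologicalSpace (LipRetractions 𝕌) :=
    TopologicalSpace.induced (retractData q) inferInstance
  have hc : Continuous (retractData q) := continuous_induced_dom
  change IsOpen S
  refine isOpen_iff_mem_nhds.2 fun U hU => ?_
  obtain ⟨X, ε, hε, hX⟩ := hS U hU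
  have hε₃ : 0 < ε / 3 := by positivity
  choose i hi using fun x => hq.exists_dist_lt x hε₃
  have hev : ∀ x ∈ X, ∀ᶠ R in 𝓝 U, dist (R.1 (q (i x))) (U.1 (q (i x))) < ε / 3 ∧
      dist (distRange R.1 (q (i x))) (distRange U.1 (q (i x))) < ε / 3 := fun x _ => by
    have hx : Filter.Tendsto (fun R => retractData q R (i x)) (𝓝 U) (𝓝 (retractData q U (i x))) :=
      ((continuous_apply (i x)).comp hc).tendsto U
    filter_upwards [hx.eventually (Metric.ball_mem_nhds _ hε₃)] with R hR
    simpa only [retractData, Prod.dist_eq, Metric.mem_ball, max_lt_iff] using hR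
  filter_upwards [(Filter.eventually_all_finset X).2 hev] with R hR
  refine hX fun x hx => ?_
  obtain ⟨h₁, h₂⟩ := hR x hx
  have h₃ := hi x
  constructor
  · have h₄ := dist_triangle4 (R.1 x) (R.1 (q (i x))) (U.1 (q (i x))) (U.1 x)
    have h₅ := R.2.dist_le x (q (i x))
    have h₆ := U.2.dist_le (q (i x)) x
    rw [dist_comm (q (i x)) x] at h₆
    linarith
  · rw [Real.dist_eq] at h₂
    have h₂ := abs_lt.1 h₂
    have h₄ := distRange_le R.1 x (q (i x))
    have h₅ := distRange_le R.1 (q (i x)) x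
    have h₆ := distRange_le U.1 x (q (i x))
    have h₇ := distRange_le U.1 (q (i x)) x
    rw [dist_comm] at h₅ h₇
    exact abs_lt.2 ⟨by linarith, by linarith⟩

theorem retractTopology_le_pointwiseTopology : retractTopology 𝕌 ≤ pointwiseTopology 𝕌 := by
  let _ := retractTopology 𝕌
  exact continuous_iff_le_induced.1 (continuous_pi continuous_apply_retractTopology)

theorem distRange_le_of_dist_le {R U : LipRetractions 𝕌} {ε : ℝ}
    (h : ∀ x, dist (R.1 x) (U.1 x) ≤ ε) (x : 𝕌) : distRange R.1 x ≤ distRange U.1 x + ε := by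
  rw [← sub_le_iff_le_add]
  refine (Metric.le_infDist ⟨_, mem_range_self x⟩).2 ?_
  rintro _ ⟨y, rfl⟩
  have h₁ : distRange R.1 x ≤ dist x (R.1 y) := Metric.infDist_le_dist_of_mem (mem_range_self y)
  have h₂ := dist_triangle x (U.1 y) (R.1 y)
  have h₃ := h y
  rw [dist_comm] at h₃
  linarith

/-- Uniformly close retractions have uniformly close images, hence uniformly close distance
functions. -/
theorem uniformTopology_le_retractTopology : uniformTopology 𝕌 ≤ retractTopology 𝕌 := by
  intro S hS
  let _ := uniformTopology 𝕌
  change IsOpen S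
  refine isOpen_iff_mem_nhds.2 fun U hU => ?_
  obtain ⟨X, ε, hε, hX⟩ := hS U hU
  have hmem : {R : LipRetractions 𝕌 | ∀ x, dist (U.1 x) (R.1 x) < ε / 2} ∈ 𝓝 U := by
    rw [nhds_induced]
    exact ⟨_, (UniformFun.hasBasis_nhds_of_basis 𝕌 𝕌 _ Metric.uniformity_basis_dist).mem_of_mem
      (half_pos hε), fun R hR => hR⟩
  filter_upwards [hmem] with R hR
  refine hX fun x _ => ⟨?_, ?_⟩
  · rw [dist_comm]
    linarith [hR x]
  · have h₁ := distRange_le_of_dist_le (fun x => (hR x).le) x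
    have h₂ := distRange_le_of_dist_le (fun x => (dist_comm (R.1 x) (U.1 x)).trans_le (hR x).le) x
    exact abs_lt.2 ⟨by linarith, by linarith⟩

/-- The points `R (q i)` are dense in the image of `R`, so `distRange R` is the limit of the minimal
distances to the first `m + 1` of them, each continuous for `τ_p`. -/
theorem exists_tendsto_retractData {q : ℕ → 𝕌} (hq : DenseRange q) :
    ∃ Ψ : ℕ → LipRetractions 𝕌 → ℕ → 𝕌 × ℝ, (∀ m, @Continuous _ _ (pointwiseTopology 𝕌) _ (Ψ m)) ∧
      ∀ R, Filter.Tendsto (fun m => Ψ m R) Filter.atTop (𝓝 (retractData q R)) := by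
  let _ := pointwiseTopology 𝕌
  have hc : ∀ x, Continuous fun R : LipRetractions 𝕌 => R.1 x := fun x =>
    (continuous_apply x).comp continuous_induced_dom
  let g : ℕ → LipRetractions 𝕌 → ℕ → ℝ := fun m R n =>
    (Finset.range (m + 1)).inf' Finset.nonempty_range_add_one fun i => dist (q n) (R.1 (q i))
  refine ⟨fun m R n => (R.1 (q n), g m R n), fun m => continuous_pi fun n => (hc _).prodMk
    (Continuous.finset_inf'_apply _ fun i _ => continuous_const.dist (hc _)), fun R => ?_⟩
  refine tendsto_pi_nhds.2 fun n => tendsto_const_nhds.prodMk_nhds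
    (Metric.tendsto_atTop.2 fun ε hε => ?_)
  obtain ⟨_, ⟨y, rfl⟩, hy⟩ := (Metric.infDist_lt_iff (x := q n) (s := range R.1)
    (r := distRange R.1 (q n) + ε / 2) ⟨_, mem_range_self (q n)⟩).1
    (lt_add_of_pos_right _ (half_pos hε))
  obtain ⟨N, hN⟩ := hq.exists_dist_lt y (half_pos hε)
  refine ⟨N, fun m hm => ?_⟩
  have h₁ : g m R n ≤ dist (q n) (R.1 (q N)) :=
    Finset.inf'_le _ (Finset.mem_range.2 (Nat.lt_succ_of_le hm))
  have h₂ : distRange R.1 (q n) ≤ g m R n := Finset.le_inf' _ _ fun i _ =>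
    Metric.infDist_le_dist_of_mem (mem_range_self _)
  have h₃ := dist_triangle (q n) (R.1 y) (R.1 (q N))
  have h₄ := R.2.dist_le y (q N)
  rw [Real.dist_eq, abs_of_nonneg (sub_nonneg.2 h₂)]
  linarith

theorem isGδσ_of_isOpen_retractTopology [TopologicalSpace.SeparableSpace 𝕌] [Nonempty 𝕌]
    {S : Set (LipRetractions 𝕌)} (hS : IsOpen[retractTopology 𝕌] S) :
    @IsGδσ _ (pointwiseTopology 𝕌) S := by
  have hq := TopologicalSpace.denseRange_denseSeq 𝕌
  rw [retractTopology_eq_induced hq] at hS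
  obtain ⟨V, hV, rfl⟩ := isOpen_induced_iff.1 hS
  obtain ⟨Ψ, h₁, h₂⟩ := exists_tendsto_retractData hq
  let _ := pointwiseTopology 𝕌
  exact isGδσ_preimage_of_tendsto h₁ h₂ hV

theorem mem_universalUltrahomogeneous_iff [TopologicalSpace.SeparableSpace 𝕌] [CompleteSpace 𝕌]
    [Nonempty 𝕌] {U : LipRetractions 𝕌} :
    U ∈ universalUltrahomogeneous 𝕌 ↔ HasExtension U.1 :=
  ⟨fun h => h.1.hasExtension h.2,
    fun h => ⟨h.isUniversalRetraction U.2, h.isUltrahomogeneousRetraction U.2⟩⟩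

theorem isGδ_universalUltrahomogeneous [TopologicalSpace.SeparableSpace 𝕌] [CompleteSpace 𝕌]
    [Nonempty 𝕌] : @IsGδ _ (retractTopology 𝕌) (universalUltrahomogeneous 𝕌) := by
  let _ := retractTopology 𝕌
  choose T hT hT' using exists_countable_dense_structures
  have : ∀ n, Countable (T n) := fun n => (hT n).to_subtype
  let q := TopologicalSpace.denseSeq 𝕌
  -- Every component is countable, so this is a countable intersection of open conditions.
  let ι := Σ n, T n × Set (Fin n) × (Fin n → ℕ) × {δ : ℚ // 0 < δ} × {η : ℚ // 0 < η}
  have : universalUltrahomogeneous 𝕌 = ⋂ x : ι, {U | MapsTo x.2.1.1.R x.2.2.1 x.2.2.1 →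
      StrictExtends U.1 x.2.1.1 x.2.2.1 (fun a => q (x.2.2.2.1 a)) x.2.2.2.2.1.1
        x.2.2.2.2.2.1} := by
    refine Set.ext fun U => ?_
    rw [mem_universalUltrahomogeneous_iff, mem_iInter]
    constructor
    · rintro h ⟨n, S, A, i, δ, η⟩ hA
      exact h.strictExtends U.2 S.1 hA _ (by exact_mod_cast δ.2) (by exact_mod_cast η.2)
    · intro h
      refine HasApproxExtension.hasExtension U.2 (.of_strictExtends U.2 hT'
        (TopologicalSpace.denseRange_denseSeq 𝕌) fun n S hS A hA i δ η hδ hη => ?_)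
      exact h ⟨n, ⟨S, hS⟩, A, i, ⟨δ, hδ⟩, ⟨η, hη⟩⟩ hA
  rw [this]
  refine .iInter_of_isOpen fun x => ?_
  simp only [imp_iff_not_or, ofPred_or]
  exact isOpen_const.union (isOpen_setOf_strictExtends continuous_apply_retractTopology
    continuous_distRange_retractTopology _ _ _ _ _)

theorem subspaceTopology_pointwise_eq_retract [TopologicalSpace.SeparableSpace 𝕌] [Nonempty 𝕌]
    (F : Set 𝕌) :
    subspaceTopology (pointwiseTopology 𝕌) F = subspaceTopology (retractTopology 𝕌) F := by
  refine le_antisymm ?_ (induced_mono retractTopology_le_pointwiseTopology)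
  rw [retractTopology_eq_induced (TopologicalSpace.denseRange_denseSeq 𝕌), subspaceTopology,
    subspaceTopology, induced_compose, induced_compose]
  let _ : TopologicalSpace (onto F) :=
    TopologicalSpace.induced ((fun R : LipRetractions 𝕌 => R.1) ∘ Subtype.val) Pi.topologicalSpace
  have hc : Continuous fun R : onto F => R.1.1 := continuous_induced_dom
  refine continuous_iff_le_induced.1 (continuous_pi fun n =>
    ((continuous_apply _).comp hc).prodMk ?_)
  have : (fun R : onto F => distRange R.1.1 (TopologicalSpace.denseSeq 𝕌 n)) =
      fun _ => Metric.infDist (TopologicalSpace.denseSeq 𝕌 n) F :=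
    funext fun R => congrArg (Metric.infDist _) R.2
  exact this ▸ continuous_const

end LipRetractions

theorem IsUrysohnSpace.nonempty {𝕌 : Type*} [MetricSpace 𝕌] (h𝕌 : IsUrysohnSpace 𝕌) :
    Nonempty 𝕌 := by
  obtain ⟨g, -⟩ := h𝕌.extension PUnit ∅ (fun x => x.2.elim) fun x => x.2.elim
  exact ⟨g PUnit.unit⟩

open LipRetractions in
theorem mainTheorem5 {𝕌 : Type*} [MetricSpace 𝕌] (h𝕌 : IsUrysohnSpace 𝕌) :
    @IsGδσδ _ (pointwiseTopology 𝕌) (universalUltrahomogeneous 𝕌) ∧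
    (@IsGδ _ (retractTopology 𝕌) (universalUltrahomogeneous 𝕌) ∧
      @IsGδ _ (uniformTopology 𝕌) (universalUltrahomogeneous 𝕌)) ∧
    ∀ F : Set 𝕌, (∃ R : LipRetractions 𝕌, range R.1 = F) →
      subspaceTopology (pointwiseTopology 𝕌) F = subspaceTopology (retractTopology 𝕌) F ∧
      @IsGδ _ (subspaceTopology (pointwiseTopology 𝕌) F) (universalUltrahomogeneousOnto F) ∧
      @IsGδ _ (subspaceTopology (retractTopology 𝕌) F) (universalUltrahomogeneousOnto F) ∧
      @IsGδ _ (subspaceTopology (uniformTopology 𝕌) F) (universalUltrahomogeneousOnto F) := by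
  have := h𝕌.complete
  have := h𝕌.separable
  have := h𝕌.nonempty
  have hr := isGδ_universalUltrahomogeneous (𝕌 := 𝕌)
  have hu : @IsGδ _ (uniformTopology 𝕌) (universalUltrahomogeneous 𝕌) :=
    @IsGδ.preimage _ _ (uniformTopology 𝕌) (retractTopology 𝕌) id _
      (continuous_id_of_le uniformTopology_le_retractTopology) hr
  have hval : ∀ (τ : TopologicalSpace (LipRetractions 𝕌)) (F : Set 𝕌),
      @IsGδ _ τ (universalUltrahomogeneous 𝕌) →
      @IsGδ _ (subspaceTopology τ F) (universalUltrahomogeneousOnto F) := fun τ F h =>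
    @IsGδ.preimage _ _ (subspaceTopology τ F) τ Subtype.val _ continuous_induced_dom h
  refine ⟨?_, ⟨hr, hu⟩, fun F _ => ?_⟩
  · obtain ⟨f, hf, hf'⟩ := (@isGδ_iff_eq_iInter_nat _ (retractTopology 𝕌) _).1 hr
    exact ⟨f, fun n => isGδσ_of_isOpen_retractTopology (hf n), hf'⟩
  · have h := subspaceTopology_pointwise_eq_retract F
    exact ⟨h, h ▸ hval _ F hr, hval _ F hr, hval _ F hu⟩
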